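/- Let $X$ be a compact connected Riemann surface and $x\in X$. Let $F\to X$ be a holomorphic vector bundle of rank $2n$, $M\to X$ a holomorphic line bundle, and $\psi:F\otimes F\to M$ a holomorphic homomorphism that is symmetric and nondegenerate on every fibre (that is, $(F,\psi)$ is an orthogonal bundle with values in $M$). Let $S_x\subset F_x$ be a subspace of dimension $n$ that is isotropic, i.e. $\psi_x|_{S_x\otimes S_x}=0$. Let $E$ be the kernel of the natural homomorphism $F\to F_x\to F_x/S_x$ (with $F_x/S_x$ regarded as a skyscraper sheaf at $x$), and let $j:E\to F$ be the inclusion. Put $L=M(-x):=M\otimes\mathcal O_X(-x)$, where $\mathcal O_X(-x)$ is the kernel of $\mathcal O_X\to\mathcal O_{X,x}/\mathfrak m_x=\mathbb C_x$, and let $\iota:L\to M$ be the homomorphism induced by $\mathcal O_X(-x)\subset\mathcal O_X$. Then $E$ is a holomorphic vector bundle of rank $2n$, $L$ is a holomorphic line bundle, and there is a unique holomorphic homomorphism $\varphi:E\otimes E\to L$ with $\iota\circ\varphi=\psi\circ(j\otimes j)$. This $\varphi$ is symmetric and nondegenerate on every fibre, so $(E,\varphi)$ is an orthogonal bundle with values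 in $M(-x)$. -/

import Mathlib

open scoped Manifold ContDiff

universe u v w

/-- A holomorphic vector bundle over `X` (a manifold modelled on `ℂ`) with typical fibre `V`. -/
structure HolBundle (X : Type u) [TopologicalSpace X] [ChartedSpace ℂ X]
    (V : Type) [NormedAddCommGroup V] [NormedSpace ℂ V] where
  fiber : X → Type v
  [addCommGroup : ∀ y, AddCommGroup (fiber y)]
  [module : ∀ y, Module ℂ (fiber y)]
  [topTotal : TopologicalSpace (Bundle.TotalSpace V fiber)]
  [topFiber : ∀ y, TopologicalSpace (fiber y)]
  [fiberBundle : FiberBundle V fiber]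
  [vectorBundle : VectorBundle ℂ V fiber]
  [holomorphic : ContMDiffVectorBundle ω V fiber 𝓘(ℂ)]

namespace HolBundle

attribute [instance] addCommGroup module topTotal topFiber fiberBundle vectorBundle holomorphic

/-- Holomorphic vector bundles of rank `r`. -/
abbrev OfRank (X : Type u) [TopologicalSpace X] [ChartedSpace ℂ X] (r : ℕ) :=
  HolBundle.{u, v} X (Fin r → ℂ)

/-- Holomorphic line bundles. -/
abbrev Line (X : Type u) [TopologicalSpace X] [ChartedSpace ℂ X] := HolBundle.{u, v} X ℂ

/-- The trivial line bundle `𝒪_X`, all of whose fibres are `ℂ`. -/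
noncomputable def trivialLine (X : Type u) [TopologicalSpace X] [ChartedSpace ℂ X] : Line.{u, 0} X where
  fiber := Bundle.Trivial X ℂ

section

variable {X : Type u} [TopologicalSpace X] [ChartedSpace ℂ X]
variable {V₁ : Type} [NormedAddCommGroup V₁] [NormedSpace ℂ V₁]
variable {V₂ : Type} [NormedAddCommGroup V₂] [NormedSpace ℂ V₂]
variable {V₃ : Type} [NormedAddCommGroup V₃] [NormedSpace ℂ V₃]

/-- `s` is a holomorphic section of `E` over `U` (its values outside `U` are irrelevant). -/
def IsSection (E : HolBundle.{u, v} X V₁) (U : Set X) (s : ∀ y, E.fiber y) : Prop :=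
  ContMDiffOn 𝓘(ℂ) (𝓘(ℂ).prod 𝓘(ℂ, V₁)) ω
    (fun y => Bundle.TotalSpace.mk' V₁ (E := E.fiber) y (s y)) U

/-- A homomorphism `E ⟶ F` of holomorphic vector bundles: a family of linear maps of the fibres
that carries holomorphic local sections to holomorphic local sections. -/
@[ext]
structure Hom (E : HolBundle.{u, v} X V₁) (F : HolBundle.{u, w} X V₂) where
  toFun : ∀ y, E.fiber y →ₗ[ℂ] F.fiber y
  holomorphic : ∀ (U : Set X), IsOpen U → ∀ s : ∀ y, E.fiber y, E.IsSection U s →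
    F.IsSection U (fun y => toFun y (s y))

universe v₁ v₂ v₃

/-- A homomorphism `E ⊗ F ⟶ L` of holomorphic vector bundles, given as a family of bilinear maps
of the fibres that carries pairs of holomorphic local sections to holomorphic local sections. -/
@[ext]
structure Pairing (E : HolBundle.{u, v₁} X V₁) (F : HolBundle.{u, v₂} X V₂)
    (L : HolBundle.{u, v₃} X V₃) where
  toFun : ∀ y, E.fiber y →ₗ[ℂ] F.fiber y →ₗ[ℂ] L.fiber y
  holomorphic : ∀ (U : Set X), IsOpen U → ∀ (s : ∀ y, E.fiber y) (t : ∀ y, F.fiber y),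
    E.IsSection U s → F.IsSection U t → L.IsSection U (fun y => toFun y (s y) (t y))

/-- `(E, φ : E ⊗ E ⟶ L)` is an orthogonal bundle: `φ` is symmetric, and nondegenerate at every
fibre. -/
structure Pairing.IsOrthogonal {E : HolBundle.{u, v} X V₁} {L : Line.{u, w} X}
    (φ : Pairing E E L) : Prop where
  symm : ∀ y a b, φ.toFun y a b = φ.toFun y b a
  nondegenerate : ∀ y, (φ.toFun y).Nondegenerate

/-- `j : E ⟶ F` is the kernel of `F ⟶ F_x ⟶ F_x / S`, where `F_x / S` is regarded as a skyscraper
sheaf at `x`: for all open `U`, the map `Γ(U, E) ⟶ Γ(U, F)` induced by `j` is injective, and its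
image consists of the sections `f` that are mapped to zero in `F_x / S` (an empty condition when
`x ∉ U`). -/
structure IsKernelAt (F : HolBundle.{u, v} X V₁) (x : X) (S : Submodule ℂ (F.fiber x))
    (E : HolBundle.{u, w} X V₂) (j : Hom E F) : Prop where
  injective : ∀ (U : Set X), IsOpen U → ∀ s s' : ∀ y, E.fiber y,
    E.IsSection U s → E.IsSection U s' →
    (∀ y ∈ U, j.toFun y (s y) = j.toFun y (s' y)) → ∀ y ∈ U, s y = s' y
  range : ∀ (U : Set X), IsOpen U → ∀ f : ∀ y, F.fiber y, F.IsSection U f →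
    ((x ∈ U → S.mkQ (f x) = 0) ↔
      ∃ s : ∀ y, E.fiber y, E.IsSection U s ∧ ∀ y ∈ U, j.toFun y (s y) = f y)

/-- The vector bundle of rank `r` that is the kernel of `F ⟶ F_x / S`, with its map to `F`. -/
structure HeckeKernel {r : ℕ} (F : OfRank.{u, v} X r) (x : X) (S : Submodule ℂ (F.fiber x)) where
  E : OfRank.{u, w} X r
  j : Hom E F
  isKernel : F.IsKernelAt x S E j

/-- The line bundle `M(-x) = M ⊗ 𝒪(-x)`. Here `N = 𝒪(-x)`, with its inclusion `σ` into `𝒪_X`, is the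
kernel of `𝒪_X ⟶ ℂ_x`, and `τ` exhibits `L` as the tensor product of `M` and `N`. -/
structure TwistNeg (M : Line.{u, v} X) (x : X) where
  N : Line.{u, w} X
  σ : Hom N (trivialLine X)
  isKernel : (trivialLine X).IsKernelAt x ⊥ N σ
  L : Line.{u, w} X
  τ : Pairing M N L
  isTensor : ∀ y, IsTensorProduct (τ.toFun y)

/-- The map `M(-x) = M ⊗ 𝒪(-x) ⟶ M ⊗ 𝒪 = M`, `m ⊗ e ↦ σ(e) m`, on fibres. -/
noncomputable def TwistNeg.incl {M : Line.{u, v} X} {x : X} (T : TwistNeg.{u, v, w} M x) (y : X) :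
    T.L.fiber y →ₗ[ℂ] M.fiber y :=
  (T.isTensor y).lift
    ((LinearMap.lsmul ℂ (M.fiber y)).flip.compl₂ (show T.N.fiber y →ₗ[ℂ] ℂ from T.σ.toFun y))

end

end HolBundle

/-! Let `z` be a local coordinate at the point considered. The map `j` carries the fibre of `E` at
`x` into the isotropic subspace `S`, so `ψ ∘ (j ⊗ j)` vanishes at `x`. It therefore factors through
the kernel of `M → M_x`, which is `M(-x)` (`exists_factor_pairing`, `TwistNeg.isKernelAt_inclHom`).
The inclusion of `M(-x)` is injective on sections, so the factor `φ` is unique, and hence symmetric.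

Away from `x`, `j` is bijective on fibres and `φ` inherits nondegeneracy from `ψ`. At `x`, let `s`
be a section of `E` with `φ(s(x), ·) = 0`. For each section `f` of `F`, `z f` lifts to `E`; pairing
`s` with the lift and cancelling `z` gives `ψ(j s, f) = 0` at `x`. So `j s` vanishes there and `j s
= z g`. Pairing `s` with sections of `E` shows in the same way that `g(x)` is orthogonal to `S`. As
`S` has half the dimension, `g(x) ∈ S`, so `g` lifts to `E`, and `s`, being `z` times the lift,
vanishes at `x` (`Pairing.isOrthogonal_of_isKernelAt`).

The bundle `E` is glued from the frames of `F`, the one at `x` being changed by `ρ + z (1 - ρ)` with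
`ρ` a projection onto `S` (`exists_isKernelAt`). The factors of `M(-x)` come from the case `S = 0`.
Kernels are given only by their sections, so claims about fibres are proved by extending vectors to
germs. -/

open Filter Topology Bundle

namespace HolBundle

/-! ### Germs of holomorphic sections and division by a coordinate. -/

section Germs

variable {X : Type u} [TopologicalSpace X] [ChartedSpace ℂ X]
variable {V : Type} [NormedAddCommGroup V] [NormedSpace ℂ V]

/-- The coordinate centred at `p` given by the preferred chart. -/
noncomputable def coordAt (p y : X) : ℂ := chartAt ℂ p y - chartAt ℂ p p

@[simp] lemma coordAt_self (p : X) : coordAt p p = 0 := sub_self _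

lemma contMDiffAt_coordAt [IsManifold 𝓘(ℂ) ω X] {p y : X} (hy : y ∈ (chartAt ℂ p).source) :
    ContMDiffAt 𝓘(ℂ) 𝓘(ℂ) ω (coordAt p) y := by
  have h : ContMDiffAt 𝓘(ℂ) 𝓘(ℂ) ω (extChartAt 𝓘(ℂ) p) y := contMDiffAt_extChartAt' hy
  exact h.sub contMDiffAt_const

lemma coordAt_ne_zero {p y : X} (hy : y ∈ (chartAt ℂ p).source) (h : y ≠ p) :
    coordAt p y ≠ 0 := fun h0 =>
  h ((chartAt ℂ p).injOn hy (mem_chart_source ℂ p) (sub_eq_zero.1 h0))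

lemma chart_source_mem_nhds (p : X) : (chartAt ℂ p).source ∈ 𝓝 p :=
  (chartAt ℂ p).open_source.mem_nhds (mem_chart_source ℂ p)

lemma eventually_coordAt_ne_zero (p : X) : ∀ᶠ y in 𝓝 p, y ≠ p → coordAt p y ≠ 0 := by
  filter_upwards [chart_source_mem_nhds p] with y hy using coordAt_ne_zero hy

/-- Points of `ℂ` are not isolated, and the inverse chart carries this to `X`. It makes limits along
`y ≠ p` unique. -/
instance nhdsNE_neBot (p : X) : (𝓝[≠] p).NeBot := by
  have h : Tendsto (chartAt ℂ p).symm (𝓝[≠] (chartAt ℂ p p)) (𝓝[≠] p) := by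
    refine tendsto_nhdsWithin_iff.2 ⟨?_, ?_⟩
    · have := (chartAt ℂ p).tendsto_symm (mem_chart_source ℂ p)
      exact this.mono_left nhdsWithin_le_nhds
    · have ht : (chartAt ℂ p).target ∈ 𝓝 (chartAt ℂ p p) :=
        (chartAt ℂ p).open_target.mem_nhds (mem_chart_target ℂ p)
      filter_upwards [nhdsWithin_le_nhds ht, self_mem_nhdsWithin] with w hw hne heq
      exact hne (by rw [← (chartAt ℂ p).right_inv hw]; exact congrArg _ heq)
  exact h.neBot

/-- A holomorphic vector-valued function that vanishes at `p` is divisible by the coordinate. -/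
lemma exists_eq_coordAt_smul [CompleteSpace V] {p : X} {g : X → V}
    (hg : ContMDiffAt 𝓘(ℂ) 𝓘(ℂ, V) ω g p) (h0 : g p = 0) :
    ∃ g' : X → V, ContMDiffAt 𝓘(ℂ) 𝓘(ℂ, V) ω g' p ∧
      ∀ y ∈ (chartAt ℂ p).source, g y = coordAt p y • g' y := by
  set c := chartAt ℂ p p
  set f : ℂ → V := g ∘ (chartAt ℂ p).symm with hf
  have hfc : f c = 0 := by simp [hf, c, h0]
  have hfa : AnalyticAt ℂ f c := by
    have h1 := (contMDiffAt_iff.1 hg).2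
    simp only [mfld_simps, contDiffWithinAt_univ] at h1
    exact h1.analyticAt
  obtain ⟨q, hq⟩ := hfa
  -- The quotient is the slope of `f` at `c`, completed by the derivative; its power series is that
  -- of `f` shifted by one.
  have hd : AnalyticAt ℂ (dslope f c) c := ⟨_, hq.has_fpower_series_dslope_fslope⟩
  refine ⟨dslope f c ∘ chartAt ℂ p, ?_, fun y hy => ?_⟩
  · have h : ContMDiffAt 𝓘(ℂ) 𝓘(ℂ) ω (extChartAt 𝓘(ℂ) p) p := contMDiffAt_extChartAt
    exact ContMDiffAt.comp p (hd.contDiffAt.contMDiffAt) h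
  · have := sub_smul_dslope f c (chartAt ℂ p y)
    rw [hfc, sub_zero] at this
    simp only [Function.comp, coordAt]
    rw [this, hf, Function.comp, (chartAt ℂ p).left_inv hy]

/-- `s` is a holomorphic section of `E` near `p`. -/
def IsSectionAt (E : HolBundle.{u, v} X V) (p : X) (s : ∀ y, E.fiber y) : Prop :=
  ContMDiffAt 𝓘(ℂ) (𝓘(ℂ).prod 𝓘(ℂ, V)) ω
    (fun y => TotalSpace.mk' V (E := E.fiber) y (s y)) p

/-- The preferred trivialization of `E` at `p`. -/
noncomputable abbrev triv (E : HolBundle.{u, v} X V) (p : X) :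
    Trivialization V (TotalSpace.proj : TotalSpace V E.fiber → X) :=
  trivializationAt V E.fiber p

lemma mem_triv (E : HolBundle.{u, v} X V) (p : X) : p ∈ (E.triv p).baseSet :=
  FiberBundle.mem_baseSet_trivializationAt' p

lemma triv_mem_nhds (E : HolBundle.{u, v} X V) (p : X) : (E.triv p).baseSet ∈ 𝓝 p :=
  (E.triv p).open_baseSet.mem_nhds (E.mem_triv p)

/-- The coordinates of vectors of `E` in the preferred trivialization at `p`. -/
noncomputable abbrev coords (E : HolBundle.{u, v} X V) (p y : X) : E.fiber y →ₗ[ℂ] V :=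
  (E.triv p).linearMapAt ℂ y

/-- The vectors of `E` with given coordinates in the preferred trivialization at `p`. -/
noncomputable abbrev ofCoords (E : HolBundle.{u, v} X V) (p y : X) : V →ₗ[ℂ] E.fiber y :=
  (E.triv p).symmₗ ℂ y

variable {E : HolBundle.{u, v} X V} {p y : X} {s t : ∀ y, E.fiber y}

lemma coords_eq (hy : y ∈ (E.triv p).baseSet) (a : E.fiber y) :
    E.coords p y a = (E.triv p ⟨y, a⟩).2 := by
  rw [coords, Trivialization.coe_linearMapAt_of_mem _ hy]

lemma ofCoords_coords (hy : y ∈ (E.triv p).baseSet) (a : E.fiber y) :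
    E.ofCoords p y (E.coords p y a) = a := (E.triv p).symmₗ_linearMapAt hy a

lemma coords_ofCoords (hy : y ∈ (E.triv p).baseSet) (a : V) :
    E.coords p y (E.ofCoords p y a) = a := (E.triv p).linearMapAt_symmₗ hy a

lemma isSectionAt_iff (hy : y ∈ (E.triv p).baseSet) :
    E.IsSectionAt y s ↔
      ContMDiffAt 𝓘(ℂ) 𝓘(ℂ, V) ω (fun q => E.coords p q (s q)) y := by
  rw [IsSectionAt, Trivialization.contMDiffAt_section_iff (E.triv p) hy]
  refine ⟨fun h => h.congr_of_eventuallyEq ?_, fun h => h.congr_of_eventuallyEq ?_⟩ <;>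
  filter_upwards [(E.triv p).open_baseSet.mem_nhds hy] with q hq
  · exact coords_eq hq _
  · exact (coords_eq hq _).symm

lemma IsSectionAt.congr (h : E.IsSectionAt p s) (hst : ∀ᶠ y in 𝓝 p, t y = s y) :
    E.IsSectionAt p t :=
  ContMDiffAt.congr_of_eventuallyEq h (hst.mono fun y hy => by simp only [hy])

lemma IsSectionAt.add (h : E.IsSectionAt p s) (h' : E.IsSectionAt p t) :
    E.IsSectionAt p (fun y => s y + t y) := by
  rw [isSectionAt_iff (E.mem_triv p)] at *
  simp only [map_add]
  exact ContMDiffAt.add h h'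

lemma IsSectionAt.sub (h : E.IsSectionAt p s) (h' : E.IsSectionAt p t) :
    E.IsSectionAt p (fun y => s y - t y) := by
  rw [isSectionAt_iff (E.mem_triv p)] at *
  simp only [map_sub]
  exact ContMDiffAt.sub h h'

lemma IsSectionAt.smul {f : X → ℂ} (h : E.IsSectionAt p s)
    (hf : ContMDiffAt 𝓘(ℂ) 𝓘(ℂ) ω f p) : E.IsSectionAt p (fun y => f y • s y) := by
  rw [isSectionAt_iff (E.mem_triv p)] at *
  simp only [map_smul]
  exact ContMDiffAt.smul hf h

lemma isSectionAt_ofCoords {g : X → V} (hy : y ∈ (E.triv p).baseSet)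
    (hg : ContMDiffAt 𝓘(ℂ) 𝓘(ℂ, V) ω g y) : E.IsSectionAt y (fun q => E.ofCoords p q (g q)) := by
  rw [isSectionAt_iff hy]
  refine hg.congr_of_eventuallyEq ?_
  filter_upwards [(E.triv p).open_baseSet.mem_nhds hy] with q hq using coords_ofCoords hq _

lemma exists_isSectionAt (a : E.fiber p) : ∃ s, E.IsSectionAt p s ∧ s p = a :=
  ⟨fun q => E.ofCoords p q (E.coords p p a), isSectionAt_ofCoords (E.mem_triv p) contMDiffAt_const,
    ofCoords_coords (E.mem_triv p) a⟩

lemma IsSectionAt.exists_eq_coordAt_smul [CompleteSpace V] (h : E.IsSectionAt p s)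
    (h0 : s p = 0) :
    ∃ s', E.IsSectionAt p s' ∧ ∀ᶠ y in 𝓝 p, s y = coordAt p y • s' y := by
  rw [isSectionAt_iff (E.mem_triv p)] at h
  obtain ⟨g, hg, hsg⟩ := HolBundle.exists_eq_coordAt_smul h (by simp [h0])
  refine ⟨_, isSectionAt_ofCoords (E.mem_triv p) hg, ?_⟩
  filter_upwards [chart_source_mem_nhds p, E.triv_mem_nhds p] with y hy hy'
  rw [← map_smul, ← hsg y hy, ofCoords_coords hy']

lemma IsSectionAt.eq_of_eventually (h : E.IsSectionAt p s) (h' : E.IsSectionAt p t)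
    (hst : ∀ᶠ y in 𝓝 p, y ≠ p → s y = t y) : s p = t p := by
  rw [isSectionAt_iff (E.mem_triv p)] at h h'
  have h1 : Tendsto (fun q => E.coords p q (s q)) (𝓝[≠] p) (𝓝 (E.coords p p (s p))) :=
    h.continuousAt.mono_left nhdsWithin_le_nhds
  have h2 : Tendsto (fun q => E.coords p q (t q)) (𝓝[≠] p) (𝓝 (E.coords p p (t p))) :=
    h'.continuousAt.mono_left nhdsWithin_le_nhds
  have h3 : E.coords p p (s p) = E.coords p p (t p) := by
    refine tendsto_nhds_unique h1 (h2.congr' ?_)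
    filter_upwards [nhdsWithin_le_nhds hst, self_mem_nhdsWithin] with q hq hne
    rw [hq hne]
  rw [← ofCoords_coords (E.mem_triv p) (s p), h3, ofCoords_coords (E.mem_triv p)]

/-- Two holomorphic sections that agree after multiplication by the coordinate agree. -/
lemma IsSectionAt.eventually_eq_of_smul (h : E.IsSectionAt p s) (h' : E.IsSectionAt p t)
    (hst : ∀ᶠ y in 𝓝 p, coordAt p y • s y = coordAt p y • t y) : ∀ᶠ y in 𝓝 p, s y = t y := by
  have h1 : ∀ᶠ y in 𝓝 p, y ≠ p → s y = t y := by
    filter_upwards [hst, eventually_coordAt_ne_zero p] with y hy hne hyp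
    exact smul_right_injective _ (hne hyp) hy
  have h2 := h.eq_of_eventually h' h1
  filter_upwards [h1] with y hy
  by_cases hyp : y = p
  · subst hyp; exact h2
  · exact hy hyp

lemma isSection_iff {U : Set X} (hU : IsOpen U) :
    E.IsSection U s ↔ ∀ y ∈ U, E.IsSectionAt y s :=
  forall₂_congr fun _ hy => ⟨fun h => h.contMDiffAt (hU.mem_nhds hy), fun h => h.contMDiffWithinAt⟩

variable [IsManifold 𝓘(ℂ) ω X]

lemma IsSectionAt.eventually (h : E.IsSectionAt p s) : ∀ᶠ y in 𝓝 p, E.IsSectionAt y s := by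
  rw [isSectionAt_iff (E.mem_triv p)] at h
  filter_upwards [(contMDiffAt_iff_contMDiffAt_nhds (by simp)).1 h,
    (E.triv p).open_baseSet.mem_nhds (E.mem_triv p)] with y hy hy'
  rwa [isSectionAt_iff hy']

/-- The passage from germs to open sets, on which `Hom`, `Pairing` and `IsKernelAt` are phrased; `P`
collects further local conditions. -/
lemma IsSectionAt.exists_isSection (h : E.IsSectionAt p s) {P : X → Prop}
    (hP : ∀ᶠ y in 𝓝 p, P y) :
    ∃ U : Set X, IsOpen U ∧ p ∈ U ∧ E.IsSection U s ∧ ∀ y ∈ U, P y := by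
  obtain ⟨U, hU, hUo, hp⟩ := eventually_nhds_iff.1 (h.eventually.and hP)
  exact ⟨U, hUo, hp, (isSection_iff hUo).2 fun y hy => (hU y hy).1, fun y hy => (hU y hy).2⟩

end Germs

section Line

variable {X : Type u} [TopologicalSpace X] [ChartedSpace ℂ X]
variable {E : Line.{u, v} X} {p y : X} {s t : ∀ y, E.fiber y}

/-- Near a point where it does not vanish, a holomorphic section is a frame of a line bundle. -/
lemma IsSectionAt.exists_eq_smul (h : E.IsSectionAt p s) (h' : E.IsSectionAt p t)
    (h0 : t p ≠ 0) :
    ∃ f : X → ℂ, ContMDiffAt 𝓘(ℂ) 𝓘(ℂ) ω f p ∧ ∀ᶠ y in 𝓝 p, s y = f y • t y := by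
  rw [isSectionAt_iff (E.mem_triv p)] at h h'
  have h1 : E.coords p p (t p) ≠ 0 := fun h2 => h0 <| by
    rw [← ofCoords_coords (E.mem_triv p) (t p), h2, map_zero]
  refine ⟨fun q => E.coords p q (s q) * (E.coords p q (t q))⁻¹, ?_, ?_⟩
  · have h2 : ContMDiffAt 𝓘(ℂ) 𝓘(ℂ) ω (fun q => (E.coords p q (t q))⁻¹) p :=
      ContMDiffAt.comp p (contDiffAt_inv ℂ h1).contMDiffAt h'
    exact ContMDiffAt.smul h h2
  · filter_upwards [E.triv_mem_nhds p, h'.continuousAt.eventually_ne h1] with q hq hne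
    calc s q = E.ofCoords p q (E.coords p q (s q)) := (ofCoords_coords hq _).symm
      _ = E.ofCoords p q ((E.coords p q (s q) * (E.coords p q (t q))⁻¹) • E.coords p q (t q)) := by
        rw [smul_eq_mul, inv_mul_cancel_right₀ hne]
      _ = _ := by rw [map_smul, ofCoords_coords hq]

end Line

end HolBundle

namespace HolBundle

universe v₁ v₂ v₃ v₄

variable {X : Type u} [TopologicalSpace X] [ChartedSpace ℂ X]
variable {V₁ : Type} [NormedAddCommGroup V₁] [NormedSpace ℂ V₁]
variable {V₂ : Type} [NormedAddCommGroup V₂] [NormedSpace ℂ V₂]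
variable {V₃ : Type} [NormedAddCommGroup V₃] [NormedSpace ℂ V₃]
variable {V₄ : Type} [NormedAddCommGroup V₄] [NormedSpace ℂ V₄]

/-! ### Homomorphisms, pairings and kernels described by germs. -/

section Constructors

variable {E : HolBundle.{u, v₁} X V₁} {F : HolBundle.{u, v₂} X V₂} {L : HolBundle.{u, v₃} X V₃}

/-- A homomorphism may be defined by its effect on germs of sections. -/
def Hom.ofGerm (h : ∀ y, E.fiber y →ₗ[ℂ] F.fiber y)
    (hh : ∀ p s, E.IsSectionAt p s → F.IsSectionAt p (fun y => h y (s y))) : Hom E F where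
  toFun := h
  holomorphic _ hU s hs :=
    (isSection_iff hU).2 fun y hy => hh y s ((isSection_iff hU).1 hs y hy)

/-- A pairing may be defined by its effect on germs of sections. -/
def Pairing.ofGerm (P : ∀ y, E.fiber y →ₗ[ℂ] F.fiber y →ₗ[ℂ] L.fiber y)
    (hP : ∀ p s t, E.IsSectionAt p s → F.IsSectionAt p t →
      L.IsSectionAt p (fun y => P y (s y) (t y))) : Pairing E F L where
  toFun := P
  holomorphic _ hU s t hs ht := (isSection_iff hU).2 fun y hy =>
    hP y s t ((isSection_iff hU).1 hs y hy) ((isSection_iff hU).1 ht y hy)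

/-- Injectivity and the image of `j` may be checked on germs of sections. -/
lemma IsKernelAt.ofGerm [IsManifold 𝓘(ℂ) ω X] {x : X} {S : Submodule ℂ (F.fiber x)} {j : Hom E F}
    (hinj : ∀ p s s', E.IsSectionAt p s → E.IsSectionAt p s' →
      (∀ᶠ y in 𝓝 p, j.toFun y (s y) = j.toFun y (s' y)) → s p = s' p)
    (hmem : ∀ a, j.toFun x a ∈ S)
    (hlift : ∀ p f, F.IsSectionAt p f → (p = x → f x ∈ S) →
      ∃ s, E.IsSectionAt p s ∧ ∀ᶠ y in 𝓝 p, j.toFun y (s y) = f y) :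
    F.IsKernelAt x S E j where
  injective U hU s s' hs hs' h y hy :=
    hinj y s s' ((isSection_iff hU).1 hs y hy) ((isSection_iff hU).1 hs' y hy)
      (eventually_of_mem (hU.mem_nhds hy) h)
  range U hU f hf := by
    constructor
    · intro hx
      have hl : ∀ p : U, ∃ s, E.IsSectionAt p s ∧ ∀ᶠ y in 𝓝 (p : X), j.toFun y (s y) = f y :=
        fun p => hlift p f ((isSection_iff hU).1 hf p p.2) fun h => by
          rw [Submodule.mkQ_apply, Submodule.Quotient.mk_eq_zero] at hx
          exact hx (h ▸ p.2)
      choose l hl hjl using hl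
      classical
      -- The global lift takes at `y` the value of the lift chosen at `y`. Near `p` it agrees with
      -- the single lift chosen at `p`, because lifts are unique by `hinj`; so it is holomorphic.
      have hkey : ∀ p (hp : p ∈ U), ∀ᶠ y in 𝓝 p,
          (if hy : y ∈ U then l ⟨y, hy⟩ y else 0) = l ⟨p, hp⟩ y := by
        intro p hp
        filter_upwards [(hjl ⟨p, hp⟩).eventually_nhds, (hl ⟨p, hp⟩).eventually,
          hU.mem_nhds hp] with q h1 h2 hq
        rw [dif_pos hq]
        refine hinj q _ _ (hl ⟨q, hq⟩) h2 ?_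
        filter_upwards [h1, hjl ⟨q, hq⟩] with y h3 h4 using h4.trans h3.symm
      refine ⟨fun y => if hy : y ∈ U then l ⟨y, hy⟩ y else 0,
        (isSection_iff hU).2 fun p hp => (hl ⟨p, hp⟩).congr (hkey p hp), fun y hy => ?_⟩
      simp only [dif_pos hy]
      exact (hjl ⟨y, hy⟩).self_of_nhds
    · rintro ⟨s, hs, hsf⟩ hx
      rw [Submodule.mkQ_apply, Submodule.Quotient.mk_eq_zero, ← hsf x hx]
      exact hmem _

end Constructors


variable [IsManifold 𝓘(ℂ) ω X]

section Apply

variable {E : HolBundle.{u, v₁} X V₁} {F : HolBundle.{u, v₂} X V₂} {L : HolBundle.{u, v₃} X V₃}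

lemma Hom.isSectionAt (h : Hom E F) {p : X} {s : ∀ y, E.fiber y} (hs : E.IsSectionAt p s) :
    F.IsSectionAt p (fun y => h.toFun y (s y)) := by
  obtain ⟨U, hU, hp, hsU, -⟩ := hs.exists_isSection (P := fun _ => True) (by simp)
  exact (isSection_iff hU).1 (h.holomorphic U hU s hsU) p hp

lemma Pairing.isSectionAt (P : Pairing E F L) {p : X} {s : ∀ y, E.fiber y} {t : ∀ y, F.fiber y}
    (hs : E.IsSectionAt p s) (ht : F.IsSectionAt p t) :
    L.IsSectionAt p (fun y => P.toFun y (s y) (t y)) := by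
  obtain ⟨U, hU, hp, hsU, ht'⟩ := hs.exists_isSection ht.eventually
  exact (isSection_iff hU).1 (P.holomorphic U hU s t hsU ((isSection_iff hU).2 ht')) p hp

end Apply

/-! ### Fibres and germs of a kernel. -/

namespace IsKernelAt

variable {F : HolBundle.{u, v₁} X V₁} {E : HolBundle.{u, v₂} X V₂} {j : Hom E F} {x p : X}
  {S : Submodule ℂ (F.fiber x)}

lemma eventually_eq (hK : F.IsKernelAt x S E j) {s s' : ∀ y, E.fiber y}
    (hs : E.IsSectionAt p s)
    (hs' : E.IsSectionAt p s') (h : ∀ᶠ y in 𝓝 p, j.toFun y (s y) = j.toFun y (s' y)) :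
    ∀ᶠ y in 𝓝 p, s y = s' y := by
  obtain ⟨U, hU, hp, hsU, hP⟩ := hs.exists_isSection (hs'.eventually.and h)
  exact eventually_of_mem (hU.mem_nhds hp) (hK.injective U hU s s' hsU
    ((isSection_iff hU).2 fun y hy => (hP y hy).1) fun y hy => (hP y hy).2)

/-- If `p ≠ x`, the neighbourhood can be shrunk to omit `x`, and the condition at `x` becomes empty.
-/
lemma exists_lift [T1Space X] (hK : F.IsKernelAt x S E j)
    {f : ∀ y, F.fiber y} (hf : F.IsSectionAt p f)
    (hx : ∀ _ : p = x, f x ∈ S) :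
    ∃ s, E.IsSectionAt p s ∧ ∀ᶠ y in 𝓝 p, j.toFun y (s y) = f y := by
  have h1 : ∀ᶠ y in 𝓝 p, p ≠ x → y ≠ x := by
    by_cases h : p = x
    · simp [h]
    · filter_upwards [isOpen_ne.mem_nhds h] with y hy _ using hy
  obtain ⟨U, hU, hp, hfU, hP⟩ := hf.exists_isSection h1
  obtain ⟨s, hs, hsf⟩ := (hK.range U hU f hfU).1 fun hxU => by
    rw [Submodule.mkQ_apply, Submodule.Quotient.mk_eq_zero]
    refine hx ?_
    by_contra h
    exact hP x hxU h rfl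
  exact ⟨s, (isSection_iff hU).1 hs p hp, eventually_of_mem (hU.mem_nhds hp) hsf⟩

lemma map_mem (hK : F.IsKernelAt x S E j) (a : E.fiber x) : j.toFun x a ∈ S := by
  obtain ⟨s, hs, rfl⟩ := exists_isSectionAt a
  obtain ⟨U, hU, hp, hsU, -⟩ := hs.exists_isSection (P := fun _ => True) (by simp)
  have := (hK.range U hU _ (j.holomorphic U hU s hsU)).2 ⟨s, hsU, fun _ _ => rfl⟩ hp
  rwa [Submodule.mkQ_apply, Submodule.Quotient.mk_eq_zero] at this

lemma exists_map_eq [T1Space X] (hK : F.IsKernelAt x S E j) {v : F.fiber x} (hv : v ∈ S) :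
    ∃ a, j.toFun x a = v := by
  obtain ⟨f, hf, rfl⟩ := exists_isSectionAt v
  obtain ⟨s, -, hs⟩ := hK.exists_lift hf fun _ => hv
  exact ⟨s x, hs.self_of_nhds⟩

lemma surjective_of_ne [T1Space X] (hK : F.IsKernelAt x S E j) (hp : p ≠ x) :
    Function.Surjective (j.toFun p) := fun v => by
  obtain ⟨f, hf, rfl⟩ := exists_isSectionAt v
  obtain ⟨s, -, hs⟩ := hK.exists_lift hf fun h => absurd h hp
  exact ⟨s p, hs.self_of_nhds⟩

/-- A section of `E` vanishes at `p` if its image is the product of the coordinate at `p` with a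
section that lifts. -/
lemma eq_zero_of_map_eq_smul (hK : F.IsKernelAt x S E j) {s s' : ∀ y, E.fiber y}
    (hs : E.IsSectionAt p s)
    (hs' : E.IsSectionAt p s')
    (h : ∀ᶠ y in 𝓝 p, j.toFun y (s y) = coordAt p y • j.toFun y (s' y)) : s p = 0 := by
  have h1 := hK.eventually_eq hs (hs'.smul (contMDiffAt_coordAt (mem_chart_source ℂ p)))
    (by simpa using h)
  simpa using h1.self_of_nhds

/-- Injectivity on sections passes to fibres by division: if `j s` vanishes at `p`, then `j s = z
g`, and `g` lifts since `p ≠ x`; so `s` is `z` times a section. -/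
lemma injective_of_ne [T1Space X] [CompleteSpace V₁] (hK : F.IsKernelAt x S E j) (hp : p ≠ x) :
    Function.Injective (j.toFun p) := by
  refine (injective_iff_map_eq_zero _).2 fun a ha => ?_
  obtain ⟨s, hs, rfl⟩ := exists_isSectionAt a
  obtain ⟨g, hg, hsg⟩ := (j.isSectionAt hs).exists_eq_coordAt_smul ha
  obtain ⟨t, ht, htg⟩ := hK.exists_lift hg fun h => absurd h hp
  refine hK.eq_zero_of_map_eq_smul hs ht ?_
  filter_upwards [hsg, htg] with y h1 h2
  rw [h1, h2]

end IsKernelAt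

/-! ### Factoring a pairing that vanishes at `x`. -/

section Factorization

variable {E : HolBundle.{u, v₁} X V₁} {F : HolBundle.{u, v₂} X V₂} {L : HolBundle.{u, v₃} X V₃}
  {M : HolBundle.{u, v₄} X V₄} {i : Hom L M} {x : X}

/-- A pairing with values in `L` is determined by the pairing with values in `M` it induces. -/
lemma Pairing.eq_of_map_eq (hi : M.IsKernelAt x ⊥ L i) (Q Q' : Pairing E F L)
    (h : ∀ y a b, i.toFun y (Q.toFun y a b) = i.toFun y (Q'.toFun y a b)) : Q = Q' := by
  ext p a b
  obtain ⟨s, hs, rfl⟩ := exists_isSectionAt a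
  obtain ⟨t, ht, rfl⟩ := exists_isSectionAt b
  exact (hi.eventually_eq (Q.isSectionAt hs ht) (Q'.isSectionAt hs ht)
    (Eventually.of_forall fun y => h y _ _)).self_of_nhds

variable [T1Space X] {P : Pairing E F M}

lemma exists_lift_pairing (hi : M.IsKernelAt x ⊥ L i) (hP : ∀ a b, P.toFun x a b = 0)
    {p : X} {s : ∀ y, E.fiber y} {t : ∀ y, F.fiber y}
    (hs : E.IsSectionAt p s) (ht : F.IsSectionAt p t) :
    ∃ l, L.IsSectionAt p l ∧ ∀ᶠ y in 𝓝 p, i.toFun y (l y) = P.toFun y (s y) (t y) :=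
  hi.exists_lift (P.isSectionAt hs ht) fun _ => (Submodule.mem_bot ℂ).2 (hP _ _)

variable [CompleteSpace V₁] [CompleteSpace V₂]

/-- The value of a lift of `P(s, t)` depends only on the values of `s` and `t`. -/
lemma lift_pairing_unique (hi : M.IsKernelAt x ⊥ L i) (hP : ∀ a b, P.toFun x a b = 0)
    {p : X} {s s' : ∀ y, E.fiber y} {t t' : ∀ y, F.fiber y}
    {l l' : ∀ y, L.fiber y} (hs : E.IsSectionAt p s) (hs' : E.IsSectionAt p s')
    (ht : F.IsSectionAt p t) (ht' : F.IsSectionAt p t') (hl : L.IsSectionAt p l)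
    (hl' : L.IsSectionAt p l') (h : ∀ᶠ y in 𝓝 p, i.toFun y (l y) = P.toFun y (s y) (t y))
    (h' : ∀ᶠ y in 𝓝 p, i.toFun y (l' y) = P.toFun y (s' y) (t' y))
    (hss : s p = s' p) (htt : t p = t' p) : l p = l' p := by
  obtain ⟨s₁, hs₁, hs₁'⟩ := (hs.sub hs').exists_eq_coordAt_smul (sub_eq_zero.2 hss)
  obtain ⟨t₁, ht₁, ht₁'⟩ := (ht.sub ht').exists_eq_coordAt_smul (sub_eq_zero.2 htt)
  obtain ⟨l₁, hl₁, hl₁'⟩ := exists_lift_pairing hi hP hs₁ ht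
  obtain ⟨l₂, hl₂, hl₂'⟩ := exists_lift_pairing hi hP hs' ht₁
  -- With `s - s' = z s₁` and `t - t' = z t₁`, `P(s, t) - P(s', t') = z (P(s₁, t) + P(s', t₁))`, and
  -- both summands lift.
  refine sub_eq_zero.1 (hi.eq_zero_of_map_eq_smul (hl.sub hl') (hl₁.add hl₂) ?_)
  filter_upwards [h, h', hs₁', ht₁', hl₁', hl₂'] with y h1 h2 h3 h4 h5 h6
  rw [map_sub, map_add, h1, h2, h5, h6, smul_add, ← LinearMap.map_smul₂, ← h3, ← map_smul, ← h4]
  simp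

/-- A pairing with values in `M` that vanishes at `x` factors through the kernel of `M ⟶ M_x`. -/
theorem exists_factor_pairing (hi : M.IsKernelAt x ⊥ L i) (hP : ∀ a b, P.toFun x a b = 0) :
    ∃ Q : Pairing E F L, ∀ y a b, i.toFun y (Q.toFun y a b) = P.toFun y a b := by
  choose s hs hsa using fun (p : X) (a : E.fiber p) => exists_isSectionAt a
  choose t ht htb using fun (p : X) (b : F.fiber p) => exists_isSectionAt b
  choose l hl hlP using fun (p : X) (a : E.fiber p) (b : F.fiber p) =>
    exists_lift_pairing hi hP (hs p a) (ht p b)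
  -- Any lift of `P(s', t')` computes the fibrewise value, whatever extensions were chosen.
  -- Bilinearity and holomorphy follow by using suitable lifts.
  have key : ∀ p s' t' l', E.IsSectionAt p s' → F.IsSectionAt p t' → L.IsSectionAt p l' →
      (∀ᶠ y in 𝓝 p, i.toFun y (l' y) = P.toFun y (s' y) (t' y)) →
      l p (s' p) (t' p) p = l' p := fun p s' t' l' hs' ht' hl' h =>
    lift_pairing_unique hi hP (hs _ _) hs' (ht _ _) ht' (hl _ _ _) hl' (hlP _ _ _) h
      (hsa _ _) (htb _ _)
  refine ⟨Pairing.ofGerm (fun p => LinearMap.mk₂ ℂ (fun a b => l p a b p) ?_ ?_ ?_ ?_) ?_, ?_⟩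
  · intro a a' b
    have := key p _ _ _ ((hs p a).add (hs p a')) (ht p b) ((hl p a b).add (hl p a' b)) (by
      filter_upwards [hlP p a b, hlP p a' b] with y h1 h2
      simp [h1, h2])
    simpa only [hsa, htb] using this
  · intro c a b
    have := key p _ _ _ ((hs p a).smul (f := fun _ => c) contMDiffAt_const) (ht p b)
      ((hl p a b).smul (f := fun _ => c) contMDiffAt_const) (by
      filter_upwards [hlP p a b] with y h1
      simp [h1])
    simpa only [hsa, htb] using this
  · intro a b b'
    have := key p _ _ _ (hs p a) ((ht p b).add (ht p b')) ((hl p a b).add (hl p a b')) (by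
      filter_upwards [hlP p a b, hlP p a b'] with y h1 h2
      simp [h1, h2])
    simpa only [hsa, htb] using this
  · intro c a b
    have := key p _ _ _ (hs p a) ((ht p b).smul (f := fun _ => c) contMDiffAt_const)
      ((hl p a b).smul (f := fun _ => c) contMDiffAt_const) (by
      filter_upwards [hlP p a b] with y h1
      simp [h1])
    simpa only [hsa, htb] using this
  · intro p s' t' hs' ht'
    obtain ⟨l', hl', h⟩ := exists_lift_pairing hi hP hs' ht'
    refine hl'.congr ?_
    filter_upwards [hs'.eventually, ht'.eventually, hl'.eventually, h.eventually_nhds]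
      with y h1 h2 h3 h4 using key y s' t' l' h1 h2 h3 h4
  · intro y a b
    change i.toFun y (l y a b y) = _
    rw [(hlP y a b).self_of_nhds, hsa, htb]

end Factorization

end HolBundle

namespace HolBundle

universe v₁ v₂ v₃

variable {X : Type u} [TopologicalSpace X] [ChartedSpace ℂ X]

/-! ### Line bundles, tensor products and orthogonal complements. -/

section Frames

variable {E : Line.{u, v} X} {p : X}

lemma IsSectionAt.eventually_ne_zero {s : ∀ y, E.fiber y} (h : E.IsSectionAt p s)
    (h0 : s p ≠ 0) : ∀ᶠ y in 𝓝 p, s y ≠ 0 := by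
  rw [isSectionAt_iff (E.mem_triv p)] at h
  have h1 : E.coords p p (s p) ≠ 0 := fun h2 => h0 <| by
    rw [← ofCoords_coords (E.mem_triv p) (s p), h2, map_zero]
  filter_upwards [h.continuousAt.eventually_ne h1] with y hy h2
  exact hy (by rw [h2, map_zero])

variable (E p) in
lemma exists_frameAt : ∃ s, E.IsSectionAt p s ∧ s p ≠ 0 :=
  ⟨fun q => E.ofCoords p q 1, isSectionAt_ofCoords (E.mem_triv p) contMDiffAt_const, fun h =>
    one_ne_zero (α := ℂ) <| (coords_ofCoords (E.mem_triv p) 1).symm.trans <|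
      (congrArg _ h).trans (map_zero _)⟩

lemma isSectionAt_trivialLine {f : X → ℂ} :
    (trivialLine X).IsSectionAt p f ↔ ContMDiffAt 𝓘(ℂ) 𝓘(ℂ) ω f p :=
  Bundle.contMDiffAt_section p

variable (E p) in
lemma finrank_fiber_line : Module.finrank ℂ (E.fiber p) = 1 := by
  rw [((E.triv p).linearEquivAt ℂ p (E.mem_triv p)).finrank_eq, Module.finrank_self]

end Frames

section Tensor

variable {A B C : Type*} [AddCommGroup A] [AddCommGroup B] [AddCommGroup C]
  [Module ℂ A] [Module ℂ B] [Module ℂ C]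

/-- Functionals `f`, `g` nonzero on `a`, `b` give the bilinear form `f(a) g(b)`, which factors
through `τ`. -/
lemma ne_zero_of_isTensorProduct {τ : A →ₗ[ℂ] B →ₗ[ℂ] C} (h : IsTensorProduct τ) {a : A} {b : B}
    (ha : a ≠ 0) (hb : b ≠ 0) : τ a b ≠ 0 := by
  obtain ⟨f, hf⟩ := Module.Projective.exists_dual_ne_zero ℂ ha
  obtain ⟨g, hg⟩ := Module.Projective.exists_dual_ne_zero ℂ hb
  intro h0
  have h1 := h.lift_eq ((LinearMap.lsmul ℂ ℂ).compl₁₂ f g) a b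
  rw [h0, map_zero] at h1
  exact mul_ne_zero hf hg h1.symm

lemma isTensorProduct_of_finrank_eq_one {τ : A →ₗ[ℂ] B →ₗ[ℂ] C} (hA : Module.finrank ℂ A = 1)
    (hB : Module.finrank ℂ B = 1) (hC : Module.finrank ℂ C = 1)
    (h : ∀ a b, a ≠ 0 → b ≠ 0 → τ a b ≠ 0) : IsTensorProduct τ := by
  have := Module.finite_of_finrank_eq_succ hA
  have := Module.finite_of_finrank_eq_succ hB
  have := Module.finite_of_finrank_eq_succ hC
  have hT : Module.finrank ℂ (TensorProduct ℂ A B) = Module.finrank ℂ C := by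
    rw [Module.finrank_tensorProduct, hA, hB, hC]
  obtain ⟨a, ha, -⟩ := finrank_eq_one_iff'.1 hA
  obtain ⟨b, hb, -⟩ := finrank_eq_one_iff'.1 hB
  have hsurj : Function.Surjective (TensorProduct.lift τ) := fun c => by
    obtain ⟨k, hk⟩ := exists_smul_eq_of_finrank_eq_one hC (h a b ha hb) c
    exact ⟨k • TensorProduct.tmul ℂ a b, by simpa using hk⟩
  exact ⟨(LinearMap.injective_iff_surjective_of_finrank_eq_finrank hT).2 hsurj, hsurj⟩

/-- A subspace of half the dimension that is isotropic for a nondegenerate form with values in a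
line is its own orthogonal. -/
lemma mem_of_orthogonal {n : ℕ} {β : A →ₗ[ℂ] A →ₗ[ℂ] C} (hA : Module.finrank ℂ A = 2 * n)
    [FiniteDimensional ℂ A] (hC : Module.finrank ℂ C = 1) (hβ : β.Nondegenerate)
    (hsymm : ∀ a b, β a b = β b a)
    {S : Submodule ℂ A} (hS : ∀ a ∈ S, ∀ b ∈ S, β a b = 0) (hn : Module.finrank ℂ S = n) {v : A}
    (hv : ∀ b ∈ S, β v b = 0) : v ∈ S := by
  have := Module.finite_of_finrank_eq_succ hC
  let e : C ≃ₗ[ℂ] ℂ := LinearEquiv.ofFinrankEq _ _ (by rw [hC, Module.finrank_self])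
  let B : LinearMap.BilinForm ℂ A := β.compr₂ e.toLinearMap
  have hB0 : ∀ a b, B a b = 0 ↔ β a b = 0 := fun a b => e.map_eq_zero_iff
  have hB : B.Nondegenerate :=
    ⟨fun a h => hβ.1 a fun b => (hB0 a b).1 (h b), fun b h => hβ.2 b fun a => (hB0 a b).1 (h a)⟩
  have hle : S ≤ B.orthogonal S := fun a ha b hb => (hB0 _ _).2 (hS b hb a ha)
  -- Isotropy gives one inclusion, and both sides have dimension `n = 2n - n`.
  have heq : S = B.orthogonal S := by
    refine Submodule.eq_of_le_of_finrank_eq hle ?_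
    rw [LinearMap.BilinForm.finrank_orthogonal hB, hA, hn]
    omega
  rw [heq]
  exact fun b hb => (hB0 _ _).2 (by rw [hsymm]; exact hv b hb)

end Tensor

/-! ### The inclusion of `M(-x)` in `M`. -/

section Twist

variable {M : Line.{u, v} X} {x : X} (T : TwistNeg.{u, v, w} M x)

/-- The inclusion of `𝒪(-x)` into `𝒪_X`, with values in `ℂ`. -/
def TwistNeg.scalar (y : X) : T.N.fiber y →ₗ[ℂ] ℂ := T.σ.toFun y

lemma TwistNeg.incl_apply (y : X) (m : M.fiber y) (e : T.N.fiber y) :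
    T.incl y (T.τ.toFun y m e) = T.scalar y e • m :=
  (T.isTensor y).lift_eq _ m e

variable [IsManifold 𝓘(ℂ) ω X]

lemma TwistNeg.contMDiffAt_scalar {p : X} {e : ∀ y, T.N.fiber y} (he : T.N.IsSectionAt p e) :
    ContMDiffAt 𝓘(ℂ) 𝓘(ℂ) ω (fun y => T.scalar y (e y)) p :=
  isSectionAt_trivialLine.1 (T.σ.isSectionAt he)

lemma TwistNeg.scalar_self (e : T.N.fiber x) : T.scalar x e = 0 :=
  (Submodule.mem_bot ℂ).1 (T.isKernel.map_mem e)

/-- Near every point, the sections of `M(-x)` are the multiples of a tensor product of frames. -/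
lemma TwistNeg.exists_frames (p : X) {l : ∀ y, T.L.fiber y} (hl : T.L.IsSectionAt p l) :
    ∃ (m : ∀ y, M.fiber y) (e : ∀ y, T.N.fiber y) (f : X → ℂ), M.IsSectionAt p m ∧ m p ≠ 0 ∧
      T.N.IsSectionAt p e ∧ e p ≠ 0 ∧ ContMDiffAt 𝓘(ℂ) 𝓘(ℂ) ω f p ∧
      ∀ᶠ y in 𝓝 p, l y = f y • T.τ.toFun y (m y) (e y) := by
  obtain ⟨m, hm, hm0⟩ := M.exists_frameAt p
  obtain ⟨e, he, he0⟩ := T.N.exists_frameAt p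
  obtain ⟨f, hf, hlf⟩ := hl.exists_eq_smul (T.τ.isSectionAt hm he)
    (ne_zero_of_isTensorProduct (T.isTensor p) hm0 he0)
  exact ⟨m, e, f, hm, hm0, he, he0, hf, hlf⟩

/-- The inclusion of `M(-x)` into `M`. -/
noncomputable def TwistNeg.inclHom : Hom T.L M :=
  Hom.ofGerm T.incl fun p l hl => by
    obtain ⟨m, e, f, hm, -, he, -, hf, hlf⟩ := T.exists_frames p hl
    refine (hm.smul (hf.mul (T.contMDiffAt_scalar he))).congr ?_
    filter_upwards [hlf] with y hy
    simp [hy, T.incl_apply, mul_smul]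

/-- In frames, `f • (m ⊗ e)` maps to `f σ(e) m`, so injectivity reduces to that of `σ`. A section `f
• m₀` vanishing at `x` has `f(x) = 0`, so `f = σ(e)` near the point and `m₀ ⊗ e` is a lift. -/
lemma TwistNeg.isKernelAt_inclHom [T1Space X] : M.IsKernelAt x ⊥ T.L T.inclHom := by
  refine IsKernelAt.ofGerm (fun p l l' hl hl' h => ?_) (fun a => ?_) fun p m hm hx => ?_
  · obtain ⟨m, e, f, hm, hm0, he, he0, hf, hlf⟩ := T.exists_frames p (hl.sub hl')
    have h1 : ∀ᶠ y in 𝓝 p, T.σ.toFun y (f y • e y) = T.σ.toFun y 0 := by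
      filter_upwards [h, hlf, hm.eventually_ne_zero hm0] with y h1 h2 h3
      have h4 : T.incl y (l y - l' y) = 0 := by rw [map_sub]; exact sub_eq_zero.2 h1
      rw [h2, map_smul, T.incl_apply, smul_smul, smul_eq_zero, or_iff_left h3] at h4
      rw [map_zero, map_smul]
      exact h4
    have h2 := (T.isKernel.eventually_eq (he.smul hf) (s' := fun _ => 0)
      (by simpa using (he.smul (f := fun _ => 0) contMDiffAt_const)) h1).self_of_nhds
    rw [smul_eq_zero, or_iff_left he0] at h2
    have h3 := hlf.self_of_nhds
    rw [h2, zero_smul] at h3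
    exact sub_eq_zero.1 h3
  · obtain ⟨l, hl, rfl⟩ := exists_isSectionAt a
    obtain ⟨m, e, f, -, -, -, -, -, hlf⟩ := T.exists_frames x hl
    change T.incl x (l x) ∈ _
    rw [hlf.self_of_nhds, map_smul, T.incl_apply, T.scalar_self]
    simp
  · obtain ⟨m₀, hm₀, hm0⟩ := M.exists_frameAt p
    obtain ⟨f, hf, hmf⟩ := hm.exists_eq_smul hm₀ hm0
    obtain ⟨e, he, hef⟩ := T.isKernel.exists_lift (f := f) (isSectionAt_trivialLine.2 hf)
      fun h => by
        subst h
        have := hx rfl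
        rw [Submodule.mem_bot, hmf.self_of_nhds, smul_eq_zero, or_iff_left hm0] at this
        exact (Submodule.mem_bot ℂ).2 this
    refine ⟨_, T.τ.isSectionAt hm₀ he, ?_⟩
    filter_upwards [hmf, hef] with y h1 h2
    refine (T.incl_apply y _ _).trans ?_
    rw [h1]
    exact congrArg (· • m₀ y) h2

end Twist

/-! ### Nondegeneracy of the induced pairing. -/

section Orthogonal

variable {V₁ : Type} [NormedAddCommGroup V₁] [NormedSpace ℂ V₁] [CompleteSpace V₁]
variable {V₂ : Type} [NormedAddCommGroup V₂] [NormedSpace ℂ V₂]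
variable [IsManifold 𝓘(ℂ) ω X]
variable {F : HolBundle.{u, v₁} X V₁} {E : HolBundle.{u, v₂} X V₂}
  {M : Line.{u, v₁} X} {L : Line.{u, v₃} X} {j : Hom E F} {i : Hom L M} {x : X}
  {S : Submodule ℂ (F.fiber x)}

/-- The value at `x` of a section of `M` whose multiple by the coordinate lifts to a section of `L`
that vanishes at `x`. -/
lemma IsKernelAt.eq_zero_of_smul_lift (hi : M.IsKernelAt x ⊥ L i) {l : ∀ y, L.fiber y}
    {m : ∀ y, M.fiber y} (hl : L.IsSectionAt x l) (hm : M.IsSectionAt x m) (h0 : l x = 0)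
    (h : ∀ᶠ y in 𝓝 x, i.toFun y (l y) = coordAt x y • m y) : m x = 0 := by
  -- Writing `l = z l'` and cancelling `z` gives `m = i l'`, and `i` is zero on the fibre at `x`.
  obtain ⟨l', hl', hll'⟩ := hl.exists_eq_coordAt_smul h0
  have h1 := hm.eventually_eq_of_smul (i.isSectionAt hl') (by
    filter_upwards [h, hll'] with y h1 h2
    rw [← h1, h2, map_smul])
  rw [h1.self_of_nhds]
  exact (Submodule.mem_bot ℂ).1 (hi.map_mem _)

theorem Pairing.isOrthogonal_of_isKernelAt [T1Space X] (hj : F.IsKernelAt x S E j)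
    (hi : M.IsKernelAt x ⊥ L i) {ψ : Pairing F F M} (hψ : ψ.IsOrthogonal)
    (hS : ∀ a ∈ S, ∀ b ∈ S, ψ.toFun x a b = 0)
    (hS' : ∀ v, (∀ b ∈ S, ψ.toFun x v b = 0) → v ∈ S) {φ : Pairing E E L}
    (hφ : ∀ y a b, i.toFun y (φ.toFun y a b) = ψ.toFun y (j.toFun y a) (j.toFun y b)) :
    φ.IsOrthogonal := by
  have hsymm : ∀ y a b, φ.toFun y a b = φ.toFun y b a := by
    have h := Pairing.eq_of_map_eq hi φ
      (Pairing.ofGerm (fun y => (φ.toFun y).flip) fun p s t hs ht => φ.isSectionAt ht hs)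
      fun y a b => by
        change _ = i.toFun y (φ.toFun y b a)
        rw [hφ, hφ, hψ.symm]
    intro y a b
    exact congrArg (fun P : Pairing E E L => P.toFun y a b) h
  have hsep : ∀ y a, (∀ b, φ.toFun y a b = 0) → a = 0 := by
    intro p a ha
    by_cases hp : p = x
    · subst hp
      obtain ⟨s, hs, rfl⟩ := exists_isSectionAt a
      -- The test sections `z f` vanish at `p`, so they lift whatever `S` is.
      have hjs : j.toFun p (s p) = 0 := by
        refine (hψ.nondegenerate p).1 _ fun b => ?_
        obtain ⟨f, hf, rfl⟩ := exists_isSectionAt b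
        obtain ⟨t, ht, htf⟩ := hj.exists_lift
          (hf.smul (contMDiffAt_coordAt (mem_chart_source ℂ p))) fun _ => by simp
        refine hi.eq_zero_of_smul_lift (φ.isSectionAt hs ht)
          (ψ.isSectionAt (j.isSectionAt hs) hf) (ha _) ?_
        filter_upwards [htf] with y hy
        rw [hφ, hy, map_smul]
      obtain ⟨g, hg, hsg⟩ := (j.isSectionAt hs).exists_eq_coordAt_smul hjs
      -- The values at `x` of images of sections of `E` fill `S`; testing `j s = z g` against them
      -- puts `g(x)` in the orthogonal of `S`.
      obtain ⟨t, ht, htg⟩ := hj.exists_lift hg fun _ => hS' _ fun b hb => by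
        obtain ⟨c, rfl⟩ := hj.exists_map_eq hb
        obtain ⟨t, ht, rfl⟩ := exists_isSectionAt c
        refine hi.eq_zero_of_smul_lift (φ.isSectionAt hs ht)
          (ψ.isSectionAt hg (j.isSectionAt ht)) (ha _) ?_
        filter_upwards [hsg] with y hy
        rw [hφ, hy, LinearMap.map_smul₂]
      refine hj.eq_zero_of_map_eq_smul hs ht ?_
      filter_upwards [hsg, htg] with y h1 h2
      rw [h1, h2]
    · refine (injective_iff_map_eq_zero _).1 (hj.injective_of_ne hp) a
        ((hψ.nondegenerate p).1 _ fun c => ?_)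
      obtain ⟨b, rfl⟩ := hj.surjective_of_ne hp c
      rw [← hφ, ha, map_zero]
  exact ⟨hsymm, fun y => ⟨hsep y, fun b hb => hsep y b fun a => by rw [hsymm, hb]⟩⟩

end Orthogonal

end HolBundle

namespace HolBundle

/-! ### Construction of the kernel bundle by a cocycle. -/

section Scaling

variable {V : Type*} [NormedAddCommGroup V] [NormedSpace ℂ V]

/-- For a projection `ρ`, the map that is the identity on the image of `ρ` and the multiplication
by `c` on its kernel. -/
noncomputable def scaling (ρ : V →L[ℂ] V) (c : ℂ) : V →L[ℂ] V :=
  ρ + c • (ContinuousLinearMap.id ℂ V - ρ)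

lemma scaling_apply (ρ : V →L[ℂ] V) (c : ℂ) (v : V) : scaling ρ c v = ρ v + c • (v - ρ v) := rfl

@[simp] lemma scaling_one (ρ : V →L[ℂ] V) (v : V) : scaling ρ 1 v = v := by
  simp [scaling_apply]

lemma scaling_scaling {ρ : V →L[ℂ] V} (hρ : ∀ v, ρ (ρ v) = ρ v) (b c : ℂ) (v : V) :
    scaling ρ b (scaling ρ c v) = scaling ρ (b * c) v := by
  simp [scaling_apply, hρ, mul_smul]

lemma scaling_inv_scaling {ρ : V →L[ℂ] V} (hρ : ∀ v, ρ (ρ v) = ρ v) {c : ℂ} (hc : c ≠ 0) (v : V) :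
    scaling ρ c⁻¹ (scaling ρ c v) = v := by
  rw [scaling_scaling hρ, inv_mul_cancel₀ hc, scaling_one]

lemma scaling_scaling_inv {ρ : V →L[ℂ] V} (hρ : ∀ v, ρ (ρ v) = ρ v) {c : ℂ} (hc : c ≠ 0) (v : V) :
    scaling ρ c (scaling ρ c⁻¹ v) = v := by
  rw [scaling_scaling hρ, mul_inv_cancel₀ hc, scaling_one]

lemma exists_projection [FiniteDimensional ℂ V] (S : Submodule ℂ V) :
    ∃ ρ : V →L[ℂ] V, (∀ v, ρ v ∈ S) ∧ ∀ v ∈ S, ρ v = v := by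
  obtain ⟨f, hf⟩ := LinearMap.exists_leftInverse_of_injective S.subtype S.ker_subtype
  refine ⟨(S.subtype ∘ₗ f).toContinuousLinearMap, fun v => (f v).2, fun v hv => ?_⟩
  exact congrArg Subtype.val (LinearMap.congr_fun hf ⟨v, hv⟩)

end Scaling

section Core

variable {X : Type u} [TopologicalSpace X] [ChartedSpace ℂ X]
variable {V : Type} [NormedAddCommGroup V] [NormedSpace ℂ V]

lemma contMDiffAt_scaling {ρ : V →L[ℂ] V} {f : X → ℂ} {y : X}
    (hf : ContMDiffAt 𝓘(ℂ) 𝓘(ℂ) ω f y) :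
    ContMDiffAt 𝓘(ℂ) 𝓘(ℂ, V →L[ℂ] V) ω (fun q => HolBundle.scaling ρ (f q)) y :=
  contMDiffAt_const.add (hf.smul contMDiffAt_const)

open scoped Classical in
/-- The coordinate centred at `x` if `p = x`, and `1` otherwise. -/
noncomputable def weight (x p y : X) : ℂ := if p = x then coordAt x y else 1

open scoped Classical in
/-- A neighbourhood of `p` that contains `x` only if `p = x`. -/
noncomputable def weightDomain (x p : X) : Set X := if p = x then (chartAt ℂ x).source else {x}ᶜ

lemma mem_weightDomain_self (x p : X) : p ∈ weightDomain x p := by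
  unfold weightDomain
  split_ifs with h
  · exact h ▸ mem_chart_source ℂ p
  · exact h

lemma isOpen_weightDomain [T1Space X] (x p : X) : IsOpen (weightDomain x p) := by
  unfold weightDomain
  split_ifs with h
  · exact (chartAt ℂ x).open_source
  · exact isOpen_compl_singleton

lemma eq_of_mem_weightDomain {x p : X} (h : x ∈ weightDomain x p) : p = x := by
  unfold weightDomain at h
  split_ifs at h with h'
  · exact h'
  · exact absurd rfl h

lemma weight_ne_zero {x p y : X} (hy : y ∈ weightDomain x p) (h : y ≠ x) : weight x p y ≠ 0 := by
  unfold weight weightDomain at *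
  split_ifs at * with h'
  · exact coordAt_ne_zero hy h
  · exact one_ne_zero

lemma contMDiffAt_weight [IsManifold 𝓘(ℂ) ω X] {x p y : X} (hy : y ∈ weightDomain x p) :
    ContMDiffAt 𝓘(ℂ) 𝓘(ℂ) ω (weight x p) y := by
  unfold weightDomain at hy
  by_cases h : p = x
  · rw [if_pos h] at hy
    convert contMDiffAt_coordAt hy using 1
    funext q
    simp [weight, h]
  · convert contMDiffAt_const (c := (1 : ℂ)) using 1
    funext q
    simp [weight, h]

variable (F : HolBundle.{u, v} X V) (x : X) (ρ : V →L[ℂ] V)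

open scoped Classical in
/-- The change of coordinates between the frames of the kernel of `F ⟶ F_x / S`. -/
noncomputable def heckeChange (p q y : X) : V →L[ℂ] V :=
  -- At `x` the weight is not invertible. Only the index `x` has `x` in its base set, and there the
  -- change of frame must be the identity.
  if y = x then ContinuousLinearMap.id ℂ V else
    (scaling ρ (weight x q y)⁻¹).comp
      (((F.triv p).coordChangeL ℂ (F.triv q) y : V →L[ℂ] V).comp (scaling ρ (weight x p y)))

variable {F x ρ}

lemma heckeChange_apply {p q y : X} (hp : y ∈ (F.triv p).baseSet) (hq : y ∈ (F.triv q).baseSet)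
    (h : y ≠ x) (v : V) : F.heckeChange x ρ p q y v = scaling ρ (weight x q y)⁻¹
      (F.coords q y (F.ofCoords p y (scaling ρ (weight x p y) v))) := by
  rw [heckeChange, if_neg h, coords_eq hq]
  simp [Trivialization.coordChangeL_apply _ _ ⟨hp, hq⟩, ofCoords, Trivialization.coe_symmₗ _ hp]

lemma heckeChange_self (hρ : ∀ v, ρ (ρ v) = ρ v) {p y : X}
    (hp : y ∈ (F.triv p).baseSet ∩ weightDomain x p) (v : V) :
    F.heckeChange x ρ p p y v = v := by
  by_cases h : y = x
  · simp [heckeChange, h]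
  · rw [heckeChange_apply hp.1 hp.1 h, coords_ofCoords hp.1,
      scaling_inv_scaling hρ (weight_ne_zero hp.2 h)]

lemma heckeChange_comp (hρ : ∀ v, ρ (ρ v) = ρ v) {p q r y : X}
    (hp : y ∈ (F.triv p).baseSet) (hq : y ∈ (F.triv q).baseSet ∩ weightDomain x q)
    (hr : y ∈ (F.triv r).baseSet) (v : V) :
    F.heckeChange x ρ q r y (F.heckeChange x ρ p q y v) = F.heckeChange x ρ p r y v := by
  by_cases h : y = x
  · simp [heckeChange, h]
  · rw [heckeChange_apply hp hq.1 h, heckeChange_apply hq.1 hr h, heckeChange_apply hp hr h,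
      scaling_scaling_inv hρ (weight_ne_zero hq.2 h), ofCoords_coords hq.1]

lemma ofCoords_heckeChange (hρ : ∀ v, ρ (ρ v) = ρ v) {p y : X}
    (hy : y ∈ (F.triv p).baseSet ∩ weightDomain x p) (v : V) :
    F.ofCoords p y (scaling ρ (weight x p y) (F.heckeChange x ρ y p y v)) =
      F.ofCoords y y (scaling ρ (weight x y y) v) := by
  by_cases h : y = x
  · subst h
    obtain rfl := eq_of_mem_weightDomain hy.2
    simp [heckeChange]
  · rw [heckeChange_apply (F.mem_triv y) hy.1 h, scaling_scaling_inv hρ (weight_ne_zero hy.2 h),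
      ofCoords_coords hy.1]

variable [IsManifold 𝓘(ℂ) ω X]

/-- Base sets of two distinct indices never both contain `x`, so the weights are invertible on the
overlap; for equal indices the change is the identity. -/
lemma contMDiffOn_heckeChange (hρ : ∀ v, ρ (ρ v) = ρ v) (p q : X) :
    ContMDiffOn 𝓘(ℂ) 𝓘(ℂ, V →L[ℂ] V) ω (F.heckeChange x ρ p q)
      (((F.triv p).baseSet ∩ weightDomain x p) ∩ ((F.triv q).baseSet ∩ weightDomain x q)) := by
  by_cases hpq : p = q
  · subst hpq
    refine (contMDiffOn_const (c := ContinuousLinearMap.id ℂ V)).congr fun y hy => ?_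
    ext v
    exact heckeChange_self hρ hy.1 v
  · have hne : ∀ y ∈ ((F.triv p).baseSet ∩ weightDomain x p) ∩
        ((F.triv q).baseSet ∩ weightDomain x q), y ≠ x := by
      rintro y ⟨⟨-, h1⟩, -, h2⟩ rfl
      exact hpq ((eq_of_mem_weightDomain h1).trans (eq_of_mem_weightDomain h2).symm)
    refine ContMDiffOn.congr (f := fun y => (scaling ρ (weight x q y)⁻¹).comp
      (((F.triv p).coordChangeL ℂ (F.triv q) y : V →L[ℂ] V).comp (scaling ρ (weight x p y))))
      (fun y hy => ContMDiffAt.contMDiffWithinAt ?_) fun y hy => by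
        rw [heckeChange, if_neg (hne y hy)]
    have h0 := weight_ne_zero hy.2.2 (hne y hy)
    have h1 : ContMDiffAt 𝓘(ℂ) 𝓘(ℂ) ω (fun q' => (weight x q q')⁻¹) y :=
      ContMDiffAt.comp y (contDiffAt_inv ℂ h0).contMDiffAt (contMDiffAt_weight hy.2.2)
    exact (contMDiffAt_scaling h1).clm_comp ((contMDiffAt_coordChangeL hy.1.1 hy.2.1).clm_comp
      (contMDiffAt_scaling (contMDiffAt_weight hy.1.2)))

variable [T1Space X]

variable (F x) in
/-- The cocycle of the kernel of `F ⟶ F_x / S`, where `S` is the image of the projection `ρ` in the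
preferred coordinates at `x`. -/
noncomputable def heckeCore (hρ : ∀ v, ρ (ρ v) = ρ v) : VectorBundleCore ℂ X V X where
  baseSet p := (F.triv p).baseSet ∩ weightDomain x p
  isOpen_baseSet p := (F.triv p).open_baseSet.inter (isOpen_weightDomain x p)
  indexAt := id
  mem_baseSet_at p := ⟨F.mem_triv p, mem_weightDomain_self x p⟩
  coordChange := F.heckeChange x ρ
  coordChange_self _ _ hy := heckeChange_self hρ hy
  continuousOn_coordChange p q := (contMDiffOn_heckeChange hρ p q).continuousOn
  coordChange_comp _ _ _ _ hy := heckeChange_comp hρ hy.1.1.1 hy.1.2 hy.2.1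

instance (hρ : ∀ v, ρ (ρ v) = ρ v) : (F.heckeCore x hρ).IsContMDiff 𝓘(ℂ) ω :=
  ⟨contMDiffOn_heckeChange hρ⟩

variable (F x) in
/-- The kernel of `F ⟶ F_x / S`, where `S` is the image of the projection `ρ` in the preferred
coordinates at `x`. -/
noncomputable def heckeBundle (hρ : ∀ v, ρ (ρ v) = ρ v) : HolBundle.{u, 0} X V where
  fiber := (F.heckeCore x hρ).Fiber

lemma mem_triv_heckeBundle {hρ : ∀ v, ρ (ρ v) = ρ v} {p y : X} :
    y ∈ ((F.heckeBundle x hρ).triv p).baseSet ↔ y ∈ (F.triv p).baseSet ∩ weightDomain x p :=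
  Iff.rfl

variable (F x) in
/-- The inclusion of the kernel of `F ⟶ F_x / S` on fibres. -/
noncomputable def heckeMap (hρ : ∀ v, ρ (ρ v) = ρ v) (y : X) :
    (F.heckeBundle x hρ).fiber y →ₗ[ℂ] F.fiber y :=
  F.ofCoords y y ∘ₗ
    (show (F.heckeBundle x hρ).fiber y →ₗ[ℂ] V from (scaling ρ (weight x y y)).toLinearMap)

lemma heckeMap_eq {hρ : ∀ v, ρ (ρ v) = ρ v} {p y : X}
    (hy : y ∈ ((F.heckeBundle x hρ).triv p).baseSet) (a : (F.heckeBundle x hρ).fiber y) :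
    F.heckeMap x hρ y a =
      F.ofCoords p y (scaling ρ (weight x p y) ((F.heckeBundle x hρ).coords p y a)) := by
  have h1 : (F.heckeBundle x hρ).coords p y a = F.heckeChange x ρ y p y a := coords_eq hy a
  rw [h1]
  exact (ofCoords_heckeChange hρ hy a).symm

lemma heckeMap_ofCoords {hρ : ∀ v, ρ (ρ v) = ρ v} {p y : X}
    (hy : y ∈ ((F.heckeBundle x hρ).triv p).baseSet) (a : V) :
    F.heckeMap x hρ y ((F.heckeBundle x hρ).ofCoords p y a) =
      F.ofCoords p y (scaling ρ (weight x p y) a) := by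
  rw [heckeMap_eq hy, coords_ofCoords hy]

lemma heckeMap_injective {hρ : ∀ v, ρ (ρ v) = ρ v} {y : X} (h : y ≠ x) :
    Function.Injective (F.heckeMap x hρ y) := by
  refine Function.LeftInverse.injective
    (g := fun b => scaling ρ (weight x y y)⁻¹ (F.coords y y b)) fun a => ?_
  change scaling ρ (weight x y y)⁻¹ (F.coords y y (F.ofCoords y y (scaling ρ (weight x y y) a))) = a
  rw [coords_ofCoords (F.mem_triv y),
    scaling_inv_scaling hρ (weight_ne_zero (mem_weightDomain_self x y) h)]

variable (F x) in
/-- The inclusion of the kernel of `F ⟶ F_x / S`. -/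
noncomputable def heckeHom (hρ : ∀ v, ρ (ρ v) = ρ v) : Hom (F.heckeBundle x hρ) F :=
  Hom.ofGerm (F.heckeMap x hρ) fun p s hs => by
    have hp := (F.heckeBundle x hρ).mem_triv p
    rw [isSectionAt_iff hp] at hs
    refine (isSectionAt_ofCoords (F.mem_triv p)
      ((contMDiffAt_scaling (ρ := ρ) (contMDiffAt_weight hp.2)).clm_apply hs)).congr ?_
    filter_upwards [(F.heckeBundle x hρ).triv_mem_nhds p] with y hy using heckeMap_eq hy _

/-- In the frame at `x` the inclusion is `ρ + z (1 - ρ)`: at `x` its image is that of `ρ`, and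
elsewhere it is invertible. -/
lemma isKernelAt_heckeHom [CompleteSpace V] (hρ : ∀ v, ρ (ρ v) = ρ v)
    {S : Submodule ℂ (F.fiber x)}
    (hS : ∀ v, F.ofCoords x x (ρ v) ∈ S) (hS' : ∀ a ∈ S, ρ (F.coords x x a) = F.coords x x a) :
    F.IsKernelAt x S (F.heckeBundle x hρ) (F.heckeHom x hρ) := by
  refine IsKernelAt.ofGerm (fun p s s' hs hs' h => ?_) (fun a => ?_) fun p f hf hx => ?_
  · refine hs.eq_of_eventually hs' ?_
    filter_upwards [h, (F.heckeBundle x hρ).triv_mem_nhds p] with y h1 h2 h3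
    refine heckeMap_injective (fun h4 => h3 ?_) h1
    subst h4
    exact (eq_of_mem_weightDomain h2.2).symm
  · have h : ∀ v, F.ofCoords x x (scaling ρ (weight x x x) v) ∈ S := fun v => by
      simpa [scaling_apply, weight] using hS v
    exact h a
  · have key : ∃ g : X → V, ContMDiffAt 𝓘(ℂ) 𝓘(ℂ, V) ω g p ∧
        ∀ᶠ y in 𝓝 p, scaling ρ (weight x p y) (g y) = F.coords p y (f y) := by
      rw [isSectionAt_iff (F.mem_triv p)] at hf
      by_cases hpx : p = x
      · subst hpx
        have h1 : ContMDiffAt 𝓘(ℂ) 𝓘(ℂ, V) ω (fun y => ρ (F.coords p y (f y))) p :=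
          (contMDiffAt_const (c := ρ)).clm_apply hf
        obtain ⟨g, hg, hfg⟩ := HolBundle.exists_eq_coordAt_smul (hf.sub h1)
          (sub_eq_zero.2 (hS' _ (hx rfl)).symm)
        -- The formal inverse `ρ + z⁻¹ (1 - ρ)` applied to `f`, with `g` in place of `z⁻¹ (f - ρ f)`
        -- and projected to the kernel of `ρ`.
        refine ⟨fun y => ρ (F.coords p y (f y)) + (g y - ρ (g y)),
          h1.add (hg.sub ((contMDiffAt_const (c := ρ)).clm_apply hg)), ?_⟩
        filter_upwards [chart_source_mem_nhds p] with y hy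
        have h2 : F.coords p y (f y) - ρ (F.coords p y (f y)) = coordAt p y • g y := hfg y hy
        have h3 : coordAt p y • ρ (g y) = 0 := by rw [← map_smul, ← h2, map_sub, hρ, sub_self]
        simp only [scaling_apply, weight, if_true, map_add, map_sub, hρ, sub_self,
          smul_sub, h3, ← h2, sub_zero]
        abel
      · exact ⟨_, hf, Eventually.of_forall fun y => by simp [weight, hpx]⟩
    obtain ⟨g, hg, hfg⟩ := key
    refine ⟨_, isSectionAt_ofCoords ((F.heckeBundle x hρ).mem_triv p) hg, ?_⟩
    filter_upwards [hfg, (F.heckeBundle x hρ).triv_mem_nhds p] with y h1 h2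
    refine (heckeMap_ofCoords h2 _).trans ?_
    exact (congrArg _ h1).trans (ofCoords_coords (mem_triv_heckeBundle.1 h2).1 _)

/-- The kernel of `F ⟶ F_x / S` is a vector bundle. -/
theorem exists_isKernelAt [FiniteDimensional ℂ V] (F : HolBundle.{u, v} X V) (x : X)
    (S : Submodule ℂ (F.fiber x)) :
    ∃ (E : HolBundle.{u, 0} X V) (j : Hom E F), F.IsKernelAt x S E j := by
  have := FiniteDimensional.complete ℂ V
  obtain ⟨ρ, hρ, hρ'⟩ := exists_projection (S.map (F.coords x x))
  refine ⟨_, _, isKernelAt_heckeHom (fun v => hρ' _ (hρ v)) (fun v => ?_)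
    fun a ha => hρ' _ (Submodule.mem_map_of_mem ha)⟩
  obtain ⟨a, ha, hav⟩ := hρ v
  rwa [← hav, ofCoords_coords (F.mem_triv x)]

end Core

/-! ### Existence of `M(-x)`. -/

section Twist

variable {X : Type u} [TopologicalSpace X] [ChartedSpace ℂ X] [IsManifold 𝓘(ℂ) ω X] [T1Space X]

/-- Take for `N` and `L` the kernels of `𝒪_X → ℂ_x` and `M → M_x`; the pairing `m ⊗ e ↦ σ(e) m`
vanishes at `x`, hence lifts to `L`. For lines, the tensor property means that nonzero vectors have
nonzero product. At `x`, if the product vanishes and `σ(e) = z f`, then `f(x) m(x) = 0`; when `m(x)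
≠ 0`, `f` lifts to `N` and `e(x) = 0`. -/
theorem nonempty_twistNeg (M : Line.{u, v} X) (x : X) : Nonempty (TwistNeg.{u, v, 0} M x) := by
  obtain ⟨N, σ, hσ⟩ := exists_isKernelAt (trivialLine X) x ⊥
  obtain ⟨L, i, hi⟩ := exists_isKernelAt M x ⊥
  let c : ∀ y, N.fiber y →ₗ[ℂ] ℂ := fun y => σ.toFun y
  have hc : ∀ p e, N.IsSectionAt p e → ContMDiffAt 𝓘(ℂ) 𝓘(ℂ) ω (fun y => c y (e y)) p :=
    fun p e he => isSectionAt_trivialLine.1 (σ.isSectionAt he)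
  let P : Pairing M N M := Pairing.ofGerm
    (fun y => (LinearMap.lsmul ℂ (M.fiber y)).flip.compl₂ (c y))
    fun p m e hm he => hm.smul (hc p e he)
  obtain ⟨τ, hτ⟩ := exists_factor_pairing (P := P) hi fun a b => by
    have : c x b = 0 := (Submodule.mem_bot ℂ).1 (hσ.map_mem b)
    change c x b • a = 0
    rw [this, zero_smul]
  have hτ' : ∀ y a b, i.toFun y (τ.toFun y a b) = c y b • a := hτ
  refine ⟨⟨N, σ, hσ, L, τ, fun p => isTensorProduct_of_finrank_eq_one (M.finrank_fiber_line p)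
    (N.finrank_fiber_line p) (L.finrank_fiber_line p) fun a b ha hb h0 => hb ?_⟩⟩
  by_cases hp : p = x
  · subst hp
    obtain ⟨m, hm, rfl⟩ := exists_isSectionAt a
    obtain ⟨e, he, rfl⟩ := exists_isSectionAt b
    obtain ⟨f, hf, hef⟩ := exists_eq_coordAt_smul (hc p e he)
      ((Submodule.mem_bot ℂ).1 (hσ.map_mem (e p)))
    have h1 := hi.eq_zero_of_smul_lift (τ.isSectionAt hm he) (hm.smul hf) h0 (by
      filter_upwards [chart_source_mem_nhds p] with y hy
      rw [hτ', hef y hy, smul_smul, smul_eq_mul])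
    rw [smul_eq_zero, or_iff_left ha] at h1
    obtain ⟨e', he', hef'⟩ := hσ.exists_lift (f := f) (isSectionAt_trivialLine.2 hf)
      fun _ => (Submodule.mem_bot ℂ).2 h1
    refine hσ.eq_zero_of_map_eq_smul he he' ?_
    filter_upwards [chart_source_mem_nhds p, hef'] with y h2 h3
    rw [h3]
    exact hef y h2
  · have h1 := hτ' p a b
    rw [h0, map_zero, eq_comm, smul_eq_zero, or_iff_left ha] at h1
    exact (injective_iff_map_eq_zero _).1 (hσ.injective_of_ne hp) b h1

end Twist

end HolBundle

/-! ### The orthogonal structure on the Hecke transform. -/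

theorem mainTheorem8 {X : Type u} [TopologicalSpace X] [ChartedSpace ℂ X] [IsManifold 𝓘(ℂ) ω X]
    [T2Space X] [CompactSpace X] [ConnectedSpace X] (x : X) (n : ℕ)
    (F : HolBundle.OfRank.{u, v} X (2 * n)) (M : HolBundle.Line.{u, v} X)
    (ψ : HolBundle.Pairing F F M) (hψ : ψ.IsOrthogonal)
    (S : Submodule ℂ (F.fiber x)) (hS : ∀ a ∈ S, ∀ b ∈ S, ψ.toFun x a b = 0)
    (hSn : Module.finrank ℂ S = n) :
    Nonempty (HolBundle.HeckeKernel.{u, v, 0} F x S) ∧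
    Nonempty (HolBundle.TwistNeg.{u, v, 0} M x) ∧
    ∀ (K : HolBundle.HeckeKernel.{u, v, w} F x S) (T : HolBundle.TwistNeg.{u, v, w} M x),
      ∃ φ : HolBundle.Pairing K.E K.E T.L,
        φ.IsOrthogonal ∧
        (∀ y a b, T.incl y (φ.toFun y a b) = ψ.toFun y (K.j.toFun y a) (K.j.toFun y b)) ∧
        ∀ φ' : HolBundle.Pairing K.E K.E T.L,
          (∀ y a b, T.incl y (φ'.toFun y a b) = ψ.toFun y (K.j.toFun y a) (K.j.toFun y b)) →
          φ' = φ := by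
  obtain ⟨E, j, hE⟩ := HolBundle.exists_isKernelAt F x S
  refine ⟨⟨⟨E, j, hE⟩⟩, HolBundle.nonempty_twistNeg M x, fun K T => ?_⟩
  have hi := T.isKernelAt_inclHom
  let P : HolBundle.Pairing K.E K.E M := HolBundle.Pairing.ofGerm
    (fun y => (ψ.toFun y).compl₁₂ (K.j.toFun y) (K.j.toFun y))
    fun p s t hs ht => ψ.isSectionAt (K.j.isSectionAt hs) (K.j.isSectionAt ht)
  obtain ⟨φ, hφ⟩ := HolBundle.exists_factor_pairing (P := P) hi fun a b =>
    hS _ (K.isKernel.map_mem a) _ (K.isKernel.map_mem b)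
  have e := (F.triv x).linearEquivAt ℂ x (F.mem_triv x)
  have hfin : FiniteDimensional ℂ (F.fiber x) := e.symm.finiteDimensional
  refine ⟨φ, HolBundle.Pairing.isOrthogonal_of_isKernelAt K.isKernel hi hψ hS (fun v hv => ?_) hφ,
    hφ, fun φ' hφ' => HolBundle.Pairing.eq_of_map_eq hi φ' φ fun y a b =>
      (hφ' y a b).trans (hφ y a b).symm⟩
  exact HolBundle.mem_of_orthogonal (by rw [e.finrank_eq, Module.finrank_fin_fun])
    (M.finrank_fiber_line x) (hψ.nondegenerate x) (hψ.symm x) hS hSn hv
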